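/- Let the hyperbolic plane have curvature $-1$ and a fixed origin $O$. A graph is a *strongly hyperbolic uniform disk graph (SHUDG) with disk radius $\varrho>0$* if it is the intersection graph of closed hyperbolic disks of radius $\varrho$ whose centres all have distance at most $2\varrho$ from $O$. There are two families of $n$-vertex SHUDGs, with $n$ unbounded in each, of disk radius $\Theta(\log n)$ such that the first has clique number $O(\log\log n)$ and treewidth $\Omega(\log n)$, and the second has clique number $\Theta(1)$ and treewidth $\Omega(\log\log n)$. More precisely, for an integer $r\ge 2$ place one point, the *root*, at $O$, and for $2\le k\le r$ place the $2^k$ points of *level* $k$ at the points with polar coordinates $\left(\rho_k,\,(2j+1)\pi/2^k\right)$, $0\le j<2^k$, where $\sinh\rho_k=\sinh(r)/\sin(\pi/2^k)$; these are the vertices of a regular $2^k$-gon centred at $O$ with side length $2r$. Let $G_r$ be the intersection graph of the closed disks of radius $r$ around all these points, and for $r\ge 8$ let $G'_r$ be the subgraph of $G_r$ induced by the root and the levels $2^m$ with $m\ge 3$, $2^m\le r$. Then: 1. Every $G_r$, $r\ge2$, is a SHUDG with disk radius $r$. As $r\to\infty$, its number of vertices $n$ tends to infinity, $r\in\Theta(\log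 n)$, the clique number of $G_r$ is in $O(\log\log n)$, and its treewidth is in $\Omega(\log n)$. 2. Every $G'_r$, $r\ge8$, is a SHUDG with disk radius $r$ and has clique number at most $5$. As $r\to\infty$, its number of vertices $n$ tends to infinity, $r\in\Theta(\log n)$, the clique number of $G'_r$ is in $\Theta(1)$, and its treewidth is in $\Omega(\log\log n)$. -/

import Mathlib

open scoped UpperHalfPlane Asymptotics

/-! ### Treewidth -/

/-- A tree decomposition of `G` with (finite) tree `T` on the node type `ι`. -/
structure TreeDecomposition {V : Type} (G : SimpleGraph V) (ι : Type) where
  T : SimpleGraph ι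
  isTree : T.IsTree
  bag : ι → Finset V
  vertex_mem : ∀ v, ∃ t, v ∈ bag t
  edge_mem : ∀ u v, G.Adj u v → ∃ t, u ∈ bag t ∧ v ∈ bag t
  connected : ∀ v, (T.induce {t | v ∈ bag t}).Connected

/-- The treewidth: the least `w` such that some finite tree decomposition has all its bags of
size at most `w + 1`. -/
noncomputable def treewidth {V : Type} (G : SimpleGraph V) : ℕ :=
  sInf {w | ∃ (ι : Type) (_ : Finite ι) (D : TreeDecomposition G ι), ∀ t, (D.bag t).card ≤ w + 1}

/-! ### Hyperbolic uniform disk graphs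

The hyperbolic plane is `ℍ`, the upper half-plane with the hyperbolic metric of curvature `-1`;
the origin is the point `UpperHalfPlane.I`. -/

/-- The intersection graph of the closed hyperbolic disks of radius `r` centred at the points
`p v`. -/
def diskGraph {V : Type} (p : V → ℍ) (r : ℝ) : SimpleGraph V where
  Adj u v := u ≠ v ∧ (Metric.closedBall (p u) r ∩ Metric.closedBall (p v) r).Nonempty
  symm := ⟨fun _ _ h => ⟨h.1.symm, Set.inter_comm _ _ ▸ h.2⟩⟩
  loopless := ⟨fun _ h => h.1 rfl⟩

/-- `G` is a strongly hyperbolic uniform disk graph with disk radius `r`. -/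
def IsSHUDG {V : Type} (G : SimpleGraph V) (r : ℝ) : Prop :=
  0 < r ∧ ∃ p : V → ℍ, G = diskGraph p r ∧ ∀ v, dist (p v) UpperHalfPlane.I ≤ 2 * r

/-! ### Polar coordinates -/

theorem polar_denom_pos (ρ φ : ℝ) : 0 < Real.cosh ρ - Real.sinh ρ * Real.cos φ := by
  have h1 : |Real.sinh ρ * Real.cos φ| ≤ |Real.sinh ρ| := by
    rw [abs_mul]
    exact mul_le_of_le_one_right (abs_nonneg _) (Real.abs_cos_le_one φ)
  have h2 : |Real.sinh ρ| < Real.cosh ρ :=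
    abs_lt.2 ⟨by rw [Real.sinh_eq, Real.cosh_eq]; linarith [Real.exp_pos ρ], Real.sinh_lt_cosh ρ⟩
  linarith [le_abs_self (Real.sinh ρ * Real.cos φ)]

/-- The point of the hyperbolic plane with polar coordinates `(ρ, φ)` around the origin, that is,
the image of `tanh (ρ / 2) * exp (φ * i)` under the isometry `w ↦ i * (1 + w) / (1 - w)` from the
Poincaré disk; the hyperbolic law of cosines for it is `cosh_dist_polarPoint`. -/
noncomputable def polarPoint (ρ φ : ℝ) : ℍ :=
  ⟨⟨-(Real.sinh ρ * Real.sin φ) / (Real.cosh ρ - Real.sinh ρ * Real.cos φ),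
    1 / (Real.cosh ρ - Real.sinh ρ * Real.cos φ)⟩, one_div_pos.2 (polar_denom_pos ρ φ)⟩

theorem cosh_dist_polarPoint (ρ φ σ ψ : ℝ) :
    Real.cosh (dist (polarPoint ρ φ) (polarPoint σ ψ)) =
      Real.cosh ρ * Real.cosh σ - Real.sinh ρ * Real.sinh σ * Real.cos (φ - ψ) := by
  have h1 := (polar_denom_pos ρ φ).ne'
  have h2 := (polar_denom_pos σ ψ).ne'
  rw [UpperHalfPlane.cosh_dist, Complex.dist_eq, ← Complex.normSq_eq_norm_sq, Complex.normSq_apply,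
    Real.cos_sub]
  simp only [polarPoint, UpperHalfPlane.im, Complex.sub_re, Complex.sub_im]
  field_simp
  have hx : (Real.sinh ρ * Real.sin φ) ^ 2 = Real.cosh ρ ^ 2 - 1 - (Real.sinh ρ * Real.cos φ) ^ 2 := by
    linear_combination Real.sinh ρ ^ 2 * Real.sin_sq_add_cos_sq φ - Real.cosh_sq ρ
  have hy : (Real.sinh σ * Real.sin ψ) ^ 2 = Real.cosh σ ^ 2 - 1 - (Real.sinh σ * Real.cos ψ) ^ 2 := by
    linear_combination Real.sinh σ ^ 2 * Real.sin_sq_add_cos_sq ψ - Real.cosh_sq σ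
  linear_combination (Real.cosh σ - Real.sinh σ * Real.cos ψ) ^ 2 * hx +
    (Real.cosh ρ - Real.sinh ρ * Real.cos φ) ^ 2 * hy

/-! ### The construction -/

/-- The vertices: the root `none`, and the vertices of a `2 ^ k`-gon for each level
`2 ≤ k ≤ r`. -/
abbrev HypergridVertex (r : ℕ) : Type := Option (Σ k : Finset.Icc 2 r, Fin (2 ^ (k : ℕ)))

/-- The level of a vertex; the root forms level `1`. -/
def hypergridLevel (r : ℕ) : HypergridVertex r → ℕ
  | none => 1
  | some v => (v.1 : ℕ)

/-- The circumradius `ρ` of the regular hyperbolic `2 ^ k`-gon with side length `2 * r`, given by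
`sinh ρ = sinh r / sin (π / 2 ^ k)`. -/
noncomputable def levelRadius (r k : ℕ) : ℝ :=
  Real.arsinh (Real.sinh r / Real.sin (Real.pi / 2 ^ k))

/-- Consecutive vertices of the polygon of level `k` indeed have distance `2 * r`. -/
theorem dist_consecutive (r k : ℕ) (hk : 2 ≤ k) (φ : ℝ) :
    dist (polarPoint (levelRadius r k) φ)
      (polarPoint (levelRadius r k) (φ + 2 * (Real.pi / 2 ^ k))) = 2 * r := by
  have hs : Real.sin (Real.pi / 2 ^ k) ≠ 0 := by
    refine (Real.sin_pos_of_pos_of_lt_pi (by positivity) ?_).ne'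
    exact div_lt_self Real.pi_pos (one_lt_pow₀ one_lt_two (by omega))
  have h : Real.sinh (levelRadius r k) * Real.sin (Real.pi / 2 ^ k) = Real.sinh r := by
    rw [levelRadius, Real.sinh_arsinh, div_mul_cancel₀ _ hs]
  have hc : Real.cosh (dist (polarPoint (levelRadius r k) φ)
      (polarPoint (levelRadius r k) (φ + 2 * (Real.pi / 2 ^ k)))) = Real.cosh (2 * r) := by
    rw [cosh_dist_polarPoint, Real.cosh_two_mul, sub_add_cancel_left, Real.cos_neg,
      Real.cos_two_mul, Real.cosh_sq (r : ℝ), ← h]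
    linear_combination Real.cosh_sq (levelRadius r k) +
      2 * Real.sinh (levelRadius r k) ^ 2 * (-Real.sin_sq_add_cos_sq (Real.pi / 2 ^ k))
  exact Real.cosh_injOn dist_nonneg (show (0 : ℝ) ≤ 2 * r by positivity) hc

/-- The position of a vertex. The vertices of the `k`-th level have the angles
`(2 * j + 1) * π / 2 ^ k`, so its sides have their midpoints at the angles `2 * j * π / 2 ^ k`, and
every other one of these is a midpoint angle of the level before. -/
noncomputable def hypergridPos (r : ℕ) : HypergridVertex r → ℍ
  | none => UpperHalfPlane.I
  | some ⟨k, j⟩ =>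
    polarPoint (levelRadius r k) ((2 * ((j : ℕ) : ℝ) + 1) * Real.pi / 2 ^ (k : ℕ))

/-- The graph `G_r`. -/
noncomputable def hypergrid (r : ℕ) : SimpleGraph (HypergridVertex r) :=
  diskGraph (hypergridPos r) r

/-- The root and the vertices of the levels `2 ^ m` with `m ≥ 3`. -/
def subHypergridSet (r : ℕ) : Set (HypergridVertex r) :=
  {v | v = none ∨ ∃ m : ℕ, 3 ≤ m ∧ hypergridLevel r v = 2 ^ m}

/-- The graph `G'_r`: the subgraph of `G_r` induced by the root and the levels `2 ^ m`, `m ≥ 3`. -/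
noncomputable def subHypergrid (r : ℕ) : SimpleGraph (subHypergridSet r) :=
  (hypergrid r).induce (subHypergridSet r)

/-! ### Connected vertex sets and the Helly property of subtrees -/

/-! Treewidth. Each polygon is a row. A vertex at angle `φ` on level `k` is adjacent to the vertex
at angle `φ + π / 2 ^ l` on every later level `l`, so paths running outward through any chosen
levels are columns that cross all rows. Unions of a row and a column pairwise intersect; by the
Helly property of subtrees one bag meets them all, hence contains a vertex of every row or of every
column (`le_treewidth_of_rows_columns`). About `r / 2` levels of `G_r`, or half of the `≈ log₂ r`
levels of `G'_r`, leave enough vertices on the innermost level to start as many columns as there are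
rows.

Cliques. By the law of cosines, adjacency on levels `k`, `l` forces `sin² (Δ / 2) ≤ sin (π / 2 ^ k)
* sin (π / 2 ^ l)` for the angle difference `Δ` (`sq_sin_half_le_of_dist_le`). Within a level only
cyclic neighbours satisfy this, so a clique has at most two vertices per level. Angles on different
levels are never equal, and three levels `a < b < c` of a clique satisfy `a + c < 2 * b + 6`
(`levels_of_triangle`). With `c` the largest level, the gaps to `c` essentially halve from each
level to the next, so a clique of `G_r` has `O(log r)` levels. Among the powers of two from `8` on,
no three levels satisfy the inequality, so a clique of `G'_r` has at most two levels, four vertices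
on them, and the root.

Finally `r` is of the order of `log n` in both families, which turns bounds in `r` into bounds in
`n`. -/

theorem SimpleGraph.induce_connected_forall {V : Type*} {G : SimpleGraph V} {A : Set V}
    (hA : (G.induce A).Preconnected) {P : V → Prop} {u : V} (hu : u ∈ A) (hPu : P u)
    (hP : ∀ x ∈ A, ∀ y ∈ A, G.Adj x y → P x → P y) {v : V} (hv : v ∈ A) : P v := by
  obtain ⟨p⟩ := hA ⟨u, hu⟩ ⟨v, hv⟩
  have key : ∀ {a b : A} (_ : (G.induce A).Walk a b), P a → P b := by
    intro a b p
    induction p with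
    | nil => exact id
    | cons h _ ih => exact fun ha => ih (hP _ (Subtype.prop _) _ (Subtype.prop _) h ha)
  exact key p hPu

theorem SimpleGraph.induce_image_Iio_connected {V : Type*} {G : SimpleGraph V} {f : ℕ → V} {n : ℕ}
    (hn : 0 < n) (hf : ∀ i, i + 1 < n → G.Adj (f i) (f (i + 1))) :
    (G.induce (f '' Set.Iio n)).Connected := by
  have key : ∀ i (hi : i < n), (G.induce (f '' Set.Iio n)).Reachable
      ⟨f 0, Set.mem_image_of_mem f hn⟩ ⟨f i, Set.mem_image_of_mem f hi⟩ := by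
    intro i
    induction i with
    | zero => exact fun _ => .refl _
    | succ i ih =>
      intro hi
      refine (ih (by omega)).trans (SimpleGraph.Adj.reachable ?_)
      exact hf i hi
  rw [SimpleGraph.connected_iff_exists_forall_reachable]
  refine ⟨⟨f 0, Set.mem_image_of_mem f hn⟩, ?_⟩
  rintro ⟨_, i, hi, rfl⟩
  exact key i hi

/-- The edge is the first one on a path from `t` into `A`. Walks inside `A` cannot use it because
they avoid `t`, so all of `A` lies on its far side. -/
theorem SimpleGraph.IsTree.exists_branch {ι : Type*} {T : SimpleGraph ι} (hT : T.IsTree)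
    {A : Set ι} (hA : (T.induce A).Connected) {t : ι} (ht : t ∉ A) :
    ∃ s, T.Adj t s ∧ ∀ u ∈ A, (T.deleteEdges {s(t, s)}).Reachable s u := by
  classical
  obtain ⟨⟨u, hu⟩⟩ := hA.nonempty
  obtain ⟨p, hp⟩ := (hT.connected.preconnected t u).exists_isPath
  cases p with
  | nil => exact absurd hu ht
  | @cons _ s _ h q =>
    refine ⟨s, h, fun v hv => ?_⟩
    rw [SimpleGraph.Walk.cons_isPath_iff] at hp
    refine SimpleGraph.induce_connected_forall hA.preconnected
      (P := fun v => (T.deleteEdges {s(t, s)}).Reachable s v) hu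
      ⟨q.toDeleteEdge _ fun he => hp.2 (q.fst_mem_support_of_mem_edges he)⟩
      (fun x hx y hy hxy hr => hr.trans (SimpleGraph.Adj.reachable ?_)) hv
    rw [SimpleGraph.deleteEdges_adj]
    refine ⟨hxy, fun he => ?_⟩
    rcases Sym2.eq_iff.1 (Set.mem_singleton_iff.1 he) with ⟨rfl, -⟩ | ⟨-, rfl⟩
    exacts [ht hx, ht hy]

/-- The Helly property: pairwise intersecting subtrees of a finite tree have a common node. -/
theorem SimpleGraph.IsTree.exists_mem_of_pairwise_inter {ι α : Type*} [Finite ι]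
    {T : SimpleGraph ι} (hT : T.IsTree) (A : α → Set ι) (hA : ∀ a, (T.induce (A a)).Connected)
    (hi : ∀ a b, (A a ∩ A b).Nonempty) : ∃ t, ∀ a, t ∈ A a := by
  classical
  have := Fintype.ofFinite ι
  by_contra! h
  choose a ha using h
  choose f hf hfA using fun t => hT.exists_branch (hA (a t)) (ha t)
  -- Without a common node, every node `t` points along an edge to a subtree missing `t`. A tree has
  -- fewer edges than nodes, so two nodes point along the same edge, from opposite ends; their
  -- subtrees lie on opposite sides of this bridge and cannot meet.
  have hcard : T.edgeFinset.card < (Finset.univ : Finset ι).card := by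
    rw [Finset.card_univ, ← hT.card_edgeFinset]
    exact Nat.lt_succ_self _
  obtain ⟨t, -, s, -, hts, he⟩ := Finset.exists_ne_map_eq_of_card_lt_of_maps_to hcard
    (f := fun t => s(t, f t)) (fun t _ => by simpa using hf t)
  rcases Sym2.eq_iff.1 he with ⟨h1, -⟩ | ⟨h1, h2⟩
  · exact hts h1
  obtain ⟨u, hut, hus⟩ := hi (a t) (a s)
  have r1 := hfA t u hut
  have r2 := hfA s u hus
  rw [h2] at r1
  rw [← h1, Sym2.eq_swap] at r2
  refine SimpleGraph.isBridge_iff.1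
    (SimpleGraph.isAcyclic_iff_forall_adj_isBridge.1 hT.isAcyclic (h2 ▸ hf t)) (r2.trans r1.symm)

/-! ### Lower bounds for the treewidth -/

namespace TreeDecomposition

variable {V ι : Type} {G : SimpleGraph V}

/-- The nodes of a tree decomposition whose bags meet a vertex set. -/
def nodes (D : TreeDecomposition G ι) (B : Set V) : Set ι :=
  {t | ∃ v ∈ B, v ∈ D.bag t}

/-- The nodes of one vertex form a subtree, and `edge_mem` makes the subtrees of adjacent vertices
overlap; connectedness of `B` chains them together. -/
theorem nodes_connected (D : TreeDecomposition G ι) {B : Set V} (hB : (G.induce B).Connected) :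
    (D.T.induce (D.nodes B)).Connected := by
  obtain ⟨⟨u, hu⟩⟩ := hB.nonempty
  obtain ⟨t, ht⟩ := D.vertex_mem u
  have sub : ∀ v ∈ B, {t | v ∈ D.bag t} ⊆ D.nodes B := fun v hv t ht => ⟨v, hv, ht⟩
  have step : ∀ v (hv : v ∈ B) s s' (hs : v ∈ D.bag s) (hs' : v ∈ D.bag s'),
      (D.T.induce (D.nodes B)).Reachable ⟨s, sub v hv hs⟩ ⟨s', sub v hv hs'⟩ :=
    fun v hv s s' hs hs' => ((D.connected v).preconnected ⟨s, hs⟩ ⟨s', hs'⟩).map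
      (SimpleGraph.induceHomOfLE _ (sub v hv)).toHom
  rw [SimpleGraph.connected_iff_exists_forall_reachable]
  refine ⟨⟨t, sub u hu ht⟩, ?_⟩
  rintro ⟨s, v, hv, hs⟩
  refine SimpleGraph.induce_connected_forall hB.preconnected
    (P := fun v => ∀ s (h : s ∈ D.nodes B), v ∈ D.bag s →
      (D.T.induce (D.nodes B)).Reachable ⟨t, sub u hu ht⟩ ⟨s, h⟩) hu
    (fun s _ h => step u hu t s ht h) (fun x hx y hy hxy hr s _ h => ?_) hv s _ hs
  obtain ⟨t', hx', hy'⟩ := D.edge_mem x y hxy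
  exact (hr t' ⟨x, hx, hx'⟩ hx').trans (step y hy t' s hy' h)

/-- A family of connected vertex sets that pairwise intersect is covered by one bag. -/
theorem exists_bag_hits {α : Type*} [Finite ι] (D : TreeDecomposition G ι) (B : α → Set V)
    (hB : ∀ a, (G.induce (B a)).Connected) (hi : ∀ a b, (B a ∩ B b).Nonempty) :
    ∃ t, ∀ a, ∃ v ∈ B a, v ∈ D.bag t :=
  D.isTree.exists_mem_of_pairwise_inter (fun a => D.nodes (B a))
    (fun a => D.nodes_connected (hB a)) fun a b => by
      obtain ⟨v, ha, hb⟩ := hi a b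
      obtain ⟨t, ht⟩ := D.vertex_mem v
      exact ⟨t, ⟨v, ha, ht⟩, v, hb, ht⟩

end TreeDecomposition

/-- The infimum is attained, and not the default `0` of `sInf ∅`, since a single bag with all
vertices is a decomposition. -/
theorem exists_treeDecomposition_treewidth {V : Type} [Finite V] (G : SimpleGraph V) :
    ∃ (ι : Type) (_ : Finite ι) (D : TreeDecomposition G ι),
      ∀ t, (D.bag t).card ≤ treewidth G + 1 := by
  have := Fintype.ofFinite V
  refine Nat.sInf_mem (s := {w | ∃ (ι : Type) (_ : Finite ι) (D : TreeDecomposition G ι),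
    ∀ t, (D.bag t).card ≤ w + 1}) ⟨Fintype.card V, Unit, inferInstance,
      ⟨⊥, ?_, fun _ => Finset.univ, by simp, by simp, fun v => ?_⟩,
      fun _ => Finset.card_le_univ _ |>.trans (Nat.le_succ _)⟩
  · exact .of_subsingleton
  · have : Nonempty {t : Unit | v ∈ (Finset.univ : Finset V)} := ⟨⟨(), by simp⟩⟩
    exact ⟨.of_subsingleton⟩

theorem card_le_of_forall_exists_mem {V : Type*} {n : ℕ} {R : Fin n → Set V}
    (hR : Pairwise fun i j => Disjoint (R i) (R j)) {X : Finset V} (h : ∀ i, ∃ v ∈ R i, v ∈ X) :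
    n ≤ X.card := by
  choose f hf hX using h
  have hinj : Function.Injective f := fun i j hij => by
    by_contra hne
    exact Set.disjoint_left.1 (hR hne) (hf i) (hij ▸ hf j)
  simpa using Finset.card_le_card_of_injOn f (s := Finset.univ) (fun i _ => hX i) hinj.injOn

/-- If `n` disjoint connected rows meet `n` disjoint connected columns, then the treewidth is at
least `n - 1`. -/
theorem le_treewidth_of_rows_columns {V : Type} [Finite V] {G : SimpleGraph V} {n : ℕ}
    (R C : Fin n → Set V) (hR : ∀ i, (G.induce (R i)).Connected)
    (hC : ∀ i, (G.induce (C i)).Connected) (dR : Pairwise fun i j => Disjoint (R i) (R j))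
    (dC : Pairwise fun i j => Disjoint (C i) (C j)) (hRC : ∀ i j, (R i ∩ C j).Nonempty) :
    n ≤ treewidth G + 1 := by
  obtain ⟨ι, _, D, hD⟩ := exists_treeDecomposition_treewidth G
  -- Two crosses meet where the row of the first meets the column of the second.
  obtain ⟨t, ht⟩ := D.exists_bag_hits (fun a : Fin n × Fin n => R a.1 ∪ C a.2)
    (fun a => SimpleGraph.induce_union_connected (hR _).preconnected (hC _).preconnected (hRC _ _))
    (fun a b => (hRC a.1 b.2).mono
      (Set.inter_subset_inter Set.subset_union_left Set.subset_union_right))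
  refine le_trans ?_ (hD t)
  -- If the bag misses a row `R i`, it must hit each cross `R i ∪ C j` in the column.
  by_cases h : ∀ i, ∃ v ∈ R i, v ∈ D.bag t
  · exact card_le_of_forall_exists_mem dR h
  · push Not at h
    obtain ⟨i, hi⟩ := h
    refine card_le_of_forall_exists_mem dC fun j => ?_
    obtain ⟨v, hv | hv, hvt⟩ := ht (i, j)
    exacts [absurd hvt (hi v hv), ⟨v, hv, hvt⟩]

/-! ### Midpoints in the hyperbolic plane -/

namespace UpperHalfPlane

theorem cosh_dist_eq (z w : ℍ) : Real.cosh (dist z w) =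
    1 + ((z.re - w.re) ^ 2 + (z.im - w.im) ^ 2) / (2 * z.im * w.im) := by
  rw [cosh_dist, Complex.dist_eq, ← Complex.normSq_eq_norm_sq, Complex.normSq_apply]
  simp only [Complex.sub_re, Complex.sub_im, coe_re, coe_im]
  ring

/-- The midpoint of two points of the hyperbolic plane. -/
noncomputable def midpoint (z w : ℍ) : ℍ :=
  ⟨⟨(z.re * w.im + w.re * z.im) / (z.im + w.im),
    2 * Real.cosh (dist z w / 2) * z.im * w.im / (z.im + w.im)⟩, by
    have := z.im_pos
    have := w.im_pos
    have := Real.cosh_pos (dist z w / 2)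
    show 0 < 2 * Real.cosh (dist z w / 2) * z.im * w.im / (z.im + w.im)
    positivity⟩

theorem midpoint_comm (z w : ℍ) : midpoint z w = midpoint w z := by
  simp only [midpoint, dist_comm z w]
  congr 2 <;> ring

/-- On the hyperboloid the midpoint is the sum of the two points divided by `2 * cosh (d / 2)`. Read
in the linear coordinates `1 / im` and `re / im`, this gives the formula defining `midpoint`. -/
theorem dist_midpoint (z w : ℍ) : dist z (midpoint z w) = dist z w / 2 := by
  refine Real.cosh_injOn dist_nonneg (show 0 ≤ dist z w / 2 by positivity) ?_
  have hz := z.im_pos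
  have hw := w.im_pos
  have h := cosh_dist_eq z w
  have hc := Real.cosh_pos (dist z w / 2)
  have h2 : Real.cosh (dist z w) = 2 * Real.cosh (dist z w / 2) ^ 2 - 1 := by
    have := Real.cosh_two_mul (dist z w / 2)
    rw [mul_div_cancel₀ _ two_ne_zero] at this
    rw [this, Real.sinh_sq]
    ring
  rw [h2] at h
  rw [cosh_dist_eq]
  have hre : (midpoint z w).re = (z.re * w.im + w.re * z.im) / (z.im + w.im) := rfl
  have him : (midpoint z w).im =
    2 * Real.cosh (dist z w / 2) * z.im * w.im / (z.im + w.im) := rfl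
  rw [hre, him]
  generalize Real.cosh (dist z w / 2) = c at *
  generalize z.im = a at *
  generalize w.im = b at *
  have hab : (z.re - w.re) ^ 2 = 4 * a * b * (c ^ 2 - 1) - (a - b) ^ 2 := by
    field_simp at h
    linarith
  field_simp
  linear_combination a ^ 2 * hab

end UpperHalfPlane

theorem closedBall_inter_nonempty_iff (z w : ℍ) (r : ℝ) :
    (Metric.closedBall z r ∩ Metric.closedBall w r).Nonempty ↔ dist z w ≤ 2 * r := by
  constructor
  · rintro ⟨u, hz, hw⟩
    rw [Metric.mem_closedBall] at hz hw
    linarith [dist_triangle_left z w u]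
  · intro h
    refine ⟨UpperHalfPlane.midpoint z w, ?_, ?_⟩
    · rw [Metric.mem_closedBall, dist_comm, UpperHalfPlane.dist_midpoint]
      linarith
    · rw [Metric.mem_closedBall, dist_comm, UpperHalfPlane.midpoint_comm,
        UpperHalfPlane.dist_midpoint, dist_comm]
      linarith

theorem diskGraph_adj {V : Type} {p : V → ℍ} {r : ℝ} {u v : V} :
    (diskGraph p r).Adj u v ↔ u ≠ v ∧ dist (p u) (p v) ≤ 2 * r :=
  and_congr_right fun _ => closedBall_inter_nonempty_iff _ _ _

/-! ### Distances between the vertices of the polygons -/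

theorem sin_pi_div_two_pow_pos {k : ℕ} (hk : 1 ≤ k) : 0 < Real.sin (Real.pi / 2 ^ k) :=
  Real.sin_pos_of_pos_of_lt_pi (by positivity)
    (div_lt_self Real.pi_pos (one_lt_pow₀ one_lt_two (by omega)))

theorem sin_pi_div_two_pow_anti {k l : ℕ} (hk : 1 ≤ k) (hkl : k ≤ l) :
    Real.sin (Real.pi / 2 ^ l) ≤ Real.sin (Real.pi / 2 ^ k) := by
  have h2 : (2 : ℝ) ^ 1 ≤ 2 ^ k := pow_le_pow_right₀ one_le_two hk
  have h1 : Real.pi / 2 ^ k ≤ Real.pi / 2 ^ 1 := by gcongr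
  have h3 : Real.pi / 2 ^ l ≤ Real.pi / 2 ^ k := by gcongr; norm_num
  have h4 : 0 < Real.pi / 2 ^ l := by positivity
  have := Real.pi_pos
  exact Real.sin_le_sin_of_le_of_le_pi_div_two (by linarith) (by linarith) h3

theorem le_sin_pi_div_two_pow {k : ℕ} (hk : 1 ≤ k) :
    2 / 2 ^ k ≤ Real.sin (Real.pi / 2 ^ k) := by
  have h2 : (2 : ℝ) ^ 1 ≤ 2 ^ k := pow_le_pow_right₀ one_le_two hk
  have h1 : Real.pi / 2 ^ k ≤ Real.pi / 2 ^ 1 := by gcongr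
  have := Real.mul_le_sin (x := Real.pi / 2 ^ k) (by positivity) (by linarith)
  convert this using 1
  field_simp

theorem sin_pi_div_two_pow_le (k : ℕ) : Real.sin (Real.pi / 2 ^ k) ≤ Real.pi / 2 ^ k :=
  Real.sin_le (by positivity)

theorem sinh_levelRadius (r k : ℕ) :
    Real.sinh (levelRadius r k) = Real.sinh r * (Real.sin (Real.pi / 2 ^ k))⁻¹ :=
  (Real.sinh_arsinh _).trans (div_eq_mul_inv _ _)

theorem two_pow_le_sinh {r : ℕ} (hr : 2 ≤ r) : (2 : ℝ) ^ (r - 1) ≤ Real.sinh r := by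
  obtain ⟨s, rfl⟩ := Nat.exists_eq_add_of_le' hr
  rw [Real.sinh_eq]
  have h1 : (2.7 : ℝ) ^ (s + 2) ≤ Real.exp (s + 2 : ℕ) := by
    rw [← Real.exp_one_pow]
    gcongr
    linarith [Real.exp_one_gt_d9]
  have h2 : Real.exp (-((s + 2 : ℕ) : ℝ)) ≤ 1 := 
    Real.exp_le_one_iff.2 (neg_nonpos.2 (Nat.cast_nonneg _))
  have h3 : (2 : ℝ) ^ s ≤ 2.7 ^ s := by gcongr; norm_num
  have h4 : (1 : ℝ) ≤ 2 ^ s := one_le_pow₀ one_le_two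
  rw [pow_add] at h1
  rw [show s + 2 - 1 = s + 1 by omega, pow_succ]
  linarith

theorem levelRadius_nonneg (r : ℕ) {k : ℕ} (hk : 1 ≤ k) : 0 ≤ levelRadius r k :=
  Real.arsinh_nonneg_iff.2
    (div_nonneg (Real.sinh_nonneg_iff.2 r.cast_nonneg) (sin_pi_div_two_pow_pos hk).le)

theorem inv_sin_pi_div_two_pow_le {k : ℕ} (hk : 1 ≤ k) :
    (Real.sin (Real.pi / 2 ^ k))⁻¹ ≤ 2 ^ (k - 1) := by
  rw [inv_le_comm₀ (sin_pi_div_two_pow_pos hk) (by positivity)]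
  refine le_trans (le_of_eq ?_) (le_sin_pi_div_two_pow hk)
  obtain ⟨k, rfl⟩ := Nat.exists_eq_add_of_le' hk
  rw [Nat.add_sub_cancel, pow_succ]
  field_simp

/-- This is where the cutoff `k ≤ r` matters: it keeps the centres within `2 * r` of the origin and
makes the column edges short enough. -/
theorem inv_sin_pi_div_two_pow_le_sinh {r k : ℕ} (hk : 2 ≤ k) (hkr : k ≤ r) :
    (Real.sin (Real.pi / 2 ^ k))⁻¹ ≤ Real.sinh r :=
  (inv_sin_pi_div_two_pow_le (by omega)).trans
    ((pow_le_pow_right₀ one_le_two (by omega)).trans (two_pow_le_sinh (hk.trans hkr)))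

theorem levelRadius_le {r k : ℕ} (hk : 2 ≤ k) (hkr : k ≤ r) : levelRadius r k ≤ 2 * r := by
  rw [← Real.sinh_le_sinh, sinh_levelRadius, Real.sinh_two_mul]
  have h1 := inv_sin_pi_div_two_pow_le_sinh hk hkr
  have h2 := Real.sinh_lt_cosh (r : ℝ)
  have h3 : 0 ≤ Real.sinh r := Real.sinh_nonneg_iff.2 r.cast_nonneg
  nlinarith

theorem polarPoint_zero : polarPoint 0 0 = UpperHalfPlane.I := by
  apply UpperHalfPlane.ext
  · apply Complex.ext <;> simp [polarPoint]

theorem dist_polarPoint_I {ρ : ℝ} (hρ : 0 ≤ ρ) (φ : ℝ) :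
    dist (polarPoint ρ φ) UpperHalfPlane.I = ρ := by
  refine Real.cosh_injOn dist_nonneg (show 0 ≤ ρ from hρ) ?_
  rw [← polarPoint_zero, cosh_dist_polarPoint]
  simp

/-- A vertex of a polygon is close to the next vertices of every later polygon. -/
theorem dist_polarPoint_levelRadius_le {r k l : ℕ} (hk : 2 ≤ k) (hkl : k < l) (hlr : l ≤ r)
    (φ : ℝ) : dist (polarPoint (levelRadius r k) φ)
      (polarPoint (levelRadius r l) (φ + Real.pi / 2 ^ l)) ≤ 2 * r := by
  have h2r : (0 : ℝ) ≤ 2 * r := by positivity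
  rw [← abs_of_nonneg h2r, ← abs_of_nonneg (dist_nonneg (x := polarPoint (levelRadius r k) φ)),
    ← Real.cosh_le_cosh, cosh_dist_polarPoint, sub_add_cancel_left, Real.cos_neg,
    Real.cosh_two_mul, Real.cosh_sq (r : ℝ)]
  have hsk := sin_pi_div_two_pow_pos (k := k) (by omega)
  have hsl := sin_pi_div_two_pow_pos (k := l) (by omega)
  have hkl' := sin_pi_div_two_pow_anti (k := k) (by omega) hkl.le
  have hBS := inv_sin_pi_div_two_pow_le_sinh (by omega) hlr
  have hk' := Real.cosh_sq (levelRadius r k)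
  have hl' := Real.cosh_sq (levelRadius r l)
  have hck := Real.cosh_pos (levelRadius r k)
  have hcl := Real.cosh_pos (levelRadius r l)
  rw [sinh_levelRadius] at hk' hl'
  rw [sinh_levelRadius, sinh_levelRadius]
  have hcos : (3 / 4 : ℝ) ≤ Real.cos (Real.pi / 2 ^ l) := by
    have h1 : Real.pi / 2 ^ l ≤ Real.pi / 2 ^ 3 := by
      gcongr
      exacts [one_le_two, by omega]
    have h2 : Real.pi / 2 ^ l ≤ 1 / 2 := by linarith [Real.pi_lt_four]
    have h3 : 0 ≤ Real.pi / 2 ^ l := by positivity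
    nlinarith [Real.one_sub_sq_div_two_le_cos (x := Real.pi / 2 ^ l)]
  have hsc := Real.sin_sq_add_cos_sq (Real.pi / 2 ^ l)
  have hAB : (Real.sin (Real.pi / 2 ^ k))⁻¹ ≤ (Real.sin (Real.pi / 2 ^ l))⁻¹ :=
    inv_anti₀ hsl hkl'
  have hA1 : 1 ≤ (Real.sin (Real.pi / 2 ^ k))⁻¹ := (one_le_inv₀ hsk).2 (Real.sin_le_one _)
  have hB : (Real.sin (Real.pi / 2 ^ l))⁻¹ * Real.sin (Real.pi / 2 ^ l) = 1 :=
    inv_mul_cancel₀ hsl.ne'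
  generalize (Real.sin (Real.pi / 2 ^ k))⁻¹ = A at *
  generalize (Real.sin (Real.pi / 2 ^ l))⁻¹ = B at *
  generalize Real.sin (Real.pi / 2 ^ l) = s at *
  generalize Real.cos (Real.pi / 2 ^ l) = c at *
  generalize Real.cosh (levelRadius r k) = x at *
  generalize Real.cosh (levelRadius r l) = y at *
  generalize Real.sinh r = S at *
  have hS : 1 ≤ S := (hA1.trans hAB).trans hBS
  have hABp : 0 ≤ A * B := by nlinarith
  have hS2 : 1 ≤ S ^ 2 := one_le_pow₀ hS
  have b1 : S ^ 2 * A ^ 2 ≤ S ^ 2 * (A * B) := by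
    gcongr; nlinarith
  have b2 : A ^ 2 ≤ S ^ 2 * (A * B) := by nlinarith
  have b3 : B ^ 2 ≤ S ^ 2 * (A * B) := by
    have e1 : B * B ≤ S * B := by gcongr; linarith
    have e2 : S * B ≤ S ^ 2 * (A * B) := by
      have : (S * B) * 1 ≤ (S * B) * (S * A) := by
        gcongr
        · nlinarith
        · nlinarith
      nlinarith
    nlinarith
  have b4 : S ^ 2 * (A * B) * (3 / 4) ≤ S ^ 2 * (A * B) * c := by gcongr
  have b5 : 0 ≤ A * B * c := by positivity
  have hrhs : 0 ≤ 1 + 2 * S ^ 2 + S ^ 2 * (A * B * c) := by positivity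
  -- After squaring, `s ^ 2 + c ^ 2 = 1` and `B * s = 1` cancel the leading term `S ^ 4 * A ^ 2 * B
  -- ^ 2`. The negative terms left, `S ^ 2 * A ^ 2`, `A ^ 2` and `B ^ 2`, are each at most `S ^ 2 *
  -- (A * B)`, and `4 * c ≥ 3` pays for all three.
  have hsq : (x * y) ^ 2 ≤ (1 + 2 * S ^ 2 + S ^ 2 * (A * B * c)) ^ 2 := by
    have hs2 : B ^ 2 * s ^ 2 = 1 := by rw [← mul_pow, hB, one_pow]
    have e : (1 + 2 * S ^ 2 + S ^ 2 * (A * B * c)) ^ 2 - (x * y) ^ 2 = S ^ 2 *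
        (4 + 4 * S ^ 2 + 2 * (A * B * c) + 4 * (S ^ 2 * (A * B) * c)
          - S ^ 2 * A ^ 2 - A ^ 2 - B ^ 2) := by
      rw [mul_pow x, hk', hl']
      linear_combination (S ^ 4 * A ^ 2 * B ^ 2) * hsc - S ^ 4 * A ^ 2 * hs2
    have : 0 ≤ S ^ 2 * (4 + 4 * S ^ 2 + 2 * (A * B * c) + 4 * (S ^ 2 * (A * B) * c)
          - S ^ 2 * A ^ 2 - A ^ 2 - B ^ 2) := mul_nonneg (by positivity) (by linarith)
    linarith
  have := abs_le_of_sq_le_sq' hsq hrhs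
  linarith [this.2]

/-- The law of cosines reads `cosh d = cosh (ρ - σ) + 2 * sinh ρ * sinh σ * sin² ((φ - ψ) / 2)`.
Compare it with `cosh (2 * r) = 1 + 2 * sinh² r`, using `cosh (ρ - σ) ≥ 1`. -/
theorem sq_sin_half_le_of_dist_le {r k l : ℕ} (hr : 0 < r) (hk : 1 ≤ k) (hl : 1 ≤ l) {φ ψ : ℝ}
    (h : dist (polarPoint (levelRadius r k) φ) (polarPoint (levelRadius r l) ψ) ≤ 2 * r) :
    Real.sin ((φ - ψ) / 2) ^ 2 ≤ Real.sin (Real.pi / 2 ^ k) * Real.sin (Real.pi / 2 ^ l) := by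
  have h2r : (0 : ℝ) ≤ 2 * r := by positivity
  rw [← abs_of_nonneg h2r, ← abs_of_nonneg (dist_nonneg (x := polarPoint (levelRadius r k) φ)),
    ← Real.cosh_le_cosh, cosh_dist_polarPoint, Real.cosh_two_mul, Real.cosh_sq (r : ℝ)] at h
  have h1 := Real.one_le_cosh (levelRadius r k - levelRadius r l)
  rw [Real.cosh_sub] at h1
  have hc : Real.cos (φ - ψ) = 1 - 2 * Real.sin ((φ - ψ) / 2) ^ 2 := by
    have := Real.cos_two_mul ((φ - ψ) / 2)
    rw [mul_div_cancel₀ _ two_ne_zero] at this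
    rw [this, Real.cos_sq']
    ring
  have hsk := sin_pi_div_two_pow_pos hk
  have hsl := sin_pi_div_two_pow_pos hl
  have hS : 0 < Real.sinh r := Real.sinh_pos_iff.2 (by exact_mod_cast hr)
  have h3 : Real.sinh (levelRadius r k) * Real.sinh (levelRadius r l) *
      Real.sin ((φ - ψ) / 2) ^ 2 ≤ Real.sinh r ^ 2 := by
    rw [hc] at h
    linarith
  rw [sinh_levelRadius, sinh_levelRadius, ← div_eq_mul_inv, ← div_eq_mul_inv, div_mul_div_comm, div_mul_eq_mul_div,
    div_le_iff₀ (by positivity), ← sq] at h3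
  exact le_of_mul_le_mul_left h3 (by positivity)

/-! ### Adjacency in the hypergrid -/

/-- The vertex with index `j` of level `k`. -/
def polygonVertex (r k j : ℕ) : HypergridVertex r :=
  if h : (2 ≤ k ∧ k ≤ r) ∧ j < 2 ^ k then some ⟨⟨k, Finset.mem_Icc.2 h.1⟩, ⟨j, h.2⟩⟩ else none

theorem hypergridLevel_polygonVertex {r k j : ℕ} (hk : 2 ≤ k) (hkr : k ≤ r) (hj : j < 2 ^ k) :
    hypergridLevel r (polygonVertex r k j) = k := by
  rw [polygonVertex, dif_pos ⟨⟨hk, hkr⟩, hj⟩]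
  rfl

theorem hypergridPos_polygonVertex {r k j : ℕ} (hk : 2 ≤ k) (hkr : k ≤ r) (hj : j < 2 ^ k) :
    hypergridPos r (polygonVertex r k j) =
      polarPoint (levelRadius r k) ((2 * (j : ℝ) + 1) * Real.pi / 2 ^ k) := by
  rw [polygonVertex, dif_pos ⟨⟨hk, hkr⟩, hj⟩]
  rfl

theorem polygonVertex_inj {r k l i j : ℕ} (hk : 2 ≤ k) (hkr : k ≤ r) (hi : i < 2 ^ k) (hl : 2 ≤ l)
    (hlr : l ≤ r) (hj : j < 2 ^ l) (h : polygonVertex r k i = polygonVertex r l j) :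
    k = l ∧ i = j := by
  have hkl : k = l := by
    rw [← hypergridLevel_polygonVertex hk hkr hi, h, hypergridLevel_polygonVertex hl hlr hj]
  subst hkl
  rw [polygonVertex, polygonVertex, dif_pos ⟨⟨hk, hkr⟩, hi⟩, dif_pos ⟨⟨hk, hkr⟩, hj⟩] at h
  simpa using h

theorem exists_eq_polygonVertex {r : ℕ} {v : HypergridVertex r} (hv : v ≠ none) :
    ∃ k j, 2 ≤ k ∧ k ≤ r ∧ j < 2 ^ k ∧ v = polygonVertex r k j := by
  rcases v with _ | ⟨⟨k, hk⟩, j⟩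
  · exact absurd rfl hv
  · have hk' := Finset.mem_Icc.1 hk
    refine ⟨k, j, hk'.1, hk'.2, j.2, ?_⟩
    rw [polygonVertex, dif_pos ⟨hk', j.2⟩]

theorem hypergrid_adj_succ {r k j : ℕ} (hk : 2 ≤ k) (hkr : k ≤ r) (hj : j + 1 < 2 ^ k) :
    (hypergrid r).Adj (polygonVertex r k j) (polygonVertex r k (j + 1)) := by
  refine diskGraph_adj.2 ⟨fun h => ?_, ?_⟩
  · have := polygonVertex_inj hk hkr (by omega) hk hkr hj h
    omega
  · rw [hypergridPos_polygonVertex hk hkr (by omega), hypergridPos_polygonVertex hk hkr hj,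
      ← dist_consecutive r k hk ((2 * (j : ℝ) + 1) * Real.pi / 2 ^ k)]
    refine le_of_eq ?_
    congr 2
    push_cast
    ring

theorem hypergrid_index_lt {k l j : ℕ} (hkl : k < l) (hj : j < 2 ^ k) :
    (2 * j + 1) * 2 ^ (l - k - 1) < 2 ^ l := by
  calc (2 * j + 1) * 2 ^ (l - k - 1) < 2 ^ (k + 1) * 2 ^ (l - k - 1) := by
        refine Nat.mul_lt_mul_of_pos_right ?_ (by positivity)
        rw [pow_succ]
        omega
    _ = 2 ^ l := by rw [← pow_add]; congr 1; omega

/-- The index is chosen so that the angle on level `l` exceeds that of the given vertex by exactly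
`π / 2 ^ l`. -/
theorem hypergrid_adj_of_lt {r k l j : ℕ} (hk : 2 ≤ k) (hkl : k < l) (hlr : l ≤ r)
    (hj : j < 2 ^ k) : (hypergrid r).Adj (polygonVertex r k j)
      (polygonVertex r l ((2 * j + 1) * 2 ^ (l - k - 1))) := by
  have hj' := hypergrid_index_lt hkl hj
  refine diskGraph_adj.2 ⟨fun h => ?_, ?_⟩
  · have := polygonVertex_inj hk (by omega) hj (by omega) hlr hj' h
    omega
  · rw [hypergridPos_polygonVertex hk (by omega) hj, hypergridPos_polygonVertex (by omega) hlr hj']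
    convert dist_polarPoint_levelRadius_le hk hkl hlr ((2 * (j : ℝ) + 1) * Real.pi / 2 ^ k) using 3
    obtain ⟨d, rfl⟩ := Nat.exists_eq_add_of_lt hkl
    rw [show k + d + 1 - k - 1 = d by omega]
    push_cast
    rw [pow_succ, pow_add]
    field_simp

theorem sq_sin_le_of_hypergrid_adj {r k l i j : ℕ} (hk : 2 ≤ k) (hkr : k ≤ r) (hi : i < 2 ^ k)
    (hl : 2 ≤ l) (hlr : l ≤ r) (hj : j < 2 ^ l)
    (h : (hypergrid r).Adj (polygonVertex r k i) (polygonVertex r l j)) :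
    Real.sin (((2 * (i : ℝ) + 1) * Real.pi / 2 ^ k - (2 * (j : ℝ) + 1) * Real.pi / 2 ^ l) / 2) ^ 2 ≤
      Real.sin (Real.pi / 2 ^ k) * Real.sin (Real.pi / 2 ^ l) := by
  have h' := (diskGraph_adj.1 h).2
  rw [hypergridPos_polygonVertex hk hkr hi, hypergridPos_polygonVertex hl hlr hj] at h'
  exact sq_sin_half_le_of_dist_le (by omega) (by omega) (by omega) h'

/-! ### The strongly hyperbolic uniform disk graphs -/

theorem dist_hypergridPos_le {r : ℕ} (v : HypergridVertex r) :
    dist (hypergridPos r v) UpperHalfPlane.I ≤ 2 * r := by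
  by_cases hv : v = none
  · subst hv
    simp [hypergridPos]
  · obtain ⟨k, j, hk, hkr, hj, rfl⟩ := exists_eq_polygonVertex hv
    rw [hypergridPos_polygonVertex hk hkr hj,
      dist_polarPoint_I (levelRadius_nonneg r (by omega))]
    exact levelRadius_le hk hkr

theorem isSHUDG_hypergrid {r : ℕ} (hr : 0 < r) : IsSHUDG (hypergrid r) (r : ℝ) :=
  ⟨by exact_mod_cast hr, hypergridPos r, rfl, dist_hypergridPos_le⟩

theorem isSHUDG_subHypergrid {r : ℕ} (hr : 0 < r) : IsSHUDG (subHypergrid r) (r : ℝ) := by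
  refine ⟨by exact_mod_cast hr, fun v => hypergridPos r v, ?_, fun v => dist_hypergridPos_le _⟩
  ext u v
  simp [subHypergrid, hypergrid, diskGraph, Subtype.ext_iff]

/-! ### Rows and columns -/

/-- The index of the column starting in the vertex with index `j` of level `κ 0` at level `κ i`. -/
def columnIndex (κ : ℕ → ℕ) (j : ℕ) : ℕ → ℕ
  | 0 => j
  | i + 1 => (2 * columnIndex κ j i + 1) * 2 ^ (κ (i + 1) - κ i - 1)

theorem columnIndex_lt {κ : ℕ → ℕ} (hκ : StrictMono κ) {j : ℕ} (hj : j < 2 ^ κ 0) (i : ℕ) :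
    columnIndex κ j i < 2 ^ κ i := by
  induction i with
  | zero => exact hj
  | succ i ih => exact hypergrid_index_lt (hκ (Nat.lt_succ_self i)) ih

theorem columnIndex_injective (κ : ℕ → ℕ) (i : ℕ) :
    Function.Injective fun j => columnIndex κ j i := by
  induction i with
  | zero => exact fun _ _ h => h
  | succ i ih =>
    intro a b h
    have h' := Nat.eq_of_mul_eq_mul_right (by positivity) h
    exact ih (show columnIndex κ a i = columnIndex κ b i by omega)

/-- A graph that contains `n` levels of the hypergrid, the first of which has at least `n`
vertices, has treewidth at least `n - 1`. -/
theorem le_treewidth_of_levels {r n : ℕ} {V : Type} [Finite V] {G : SimpleGraph V} {κ : ℕ → ℕ}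
    (hκ : StrictMono κ) (h0 : 2 ≤ κ 0) (hr : ∀ i < n, κ i ≤ r) (hn : n ≤ 2 ^ κ 0)
    (ψ : HypergridVertex r → V) (hinj : Set.InjOn ψ {v | ∃ i < n, hypergridLevel r v = κ i})
    (hadj : ∀ u v, (∃ i < n, hypergridLevel r u = κ i) → (∃ i < n, hypergridLevel r v = κ i) →
      (hypergrid r).Adj u v → G.Adj (ψ u) (ψ v)) : n ≤ treewidth G + 1 := by
  have h2 : ∀ i, 2 ≤ κ i := fun i => h0.trans (hκ.monotone (Nat.zero_le i))
  have hlev : ∀ i < n, ∀ j < 2 ^ κ i,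
      ∃ i' < n, hypergridLevel r (polygonVertex r (κ i) j) = κ i' :=
    fun i hi j hj => ⟨i, hi, hypergridLevel_polygonVertex (h2 i) (hr i hi) hj⟩
  have hcol : ∀ (c : Fin n) i, columnIndex κ c i < 2 ^ κ i :=
    fun c i => columnIndex_lt hκ (c.2.trans_le hn) i
  -- Rows are the polygons without their closing edge. The columns start in the first `n` vertices
  -- of level `κ 0`, and are disjoint because each outward step is injective on indices.
  refine le_treewidth_of_rows_columns
    (fun a => (fun j => ψ (polygonVertex r (κ a) j)) '' Set.Iio (2 ^ κ a))
    (fun c => (fun i => ψ (polygonVertex r (κ i) (columnIndex κ c i))) '' Set.Iio n)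
    (fun a => SimpleGraph.induce_image_Iio_connected (by positivity) fun j hj => ?_)
    (fun c => SimpleGraph.induce_image_Iio_connected c.pos fun i hi => ?_)
    (fun a b hab => ?_) (fun c d hcd => ?_) (fun a c => ?_)
  · exact hadj _ _ (hlev a a.2 _ (by omega)) (hlev a a.2 _ hj)
      (hypergrid_adj_succ (h2 a) (hr a a.2) hj)
  · exact hadj _ _ (hlev i (by omega) _ (hcol c i)) (hlev _ hi _ (hcol c _))
      (hypergrid_adj_of_lt (h2 i) (hκ (Nat.lt_succ_self i)) (hr _ hi) (hcol c i))
  · refine Set.disjoint_left.2 ?_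
    rintro _ ⟨i, hi, rfl⟩ ⟨j, hj, h⟩
    have := hinj (hlev b b.2 _ hj) (hlev a a.2 _ hi) h
    have := polygonVertex_inj (h2 _) (hr b b.2) hj (h2 _) (hr a a.2) hi this
    exact hab (Fin.ext (hκ.injective this.1.symm))
  · refine Set.disjoint_left.2 ?_
    rintro _ ⟨i, hi, rfl⟩ ⟨j, hj, h⟩
    have := hinj (hlev j hj _ (hcol d j)) (hlev i hi _ (hcol c i)) h
    have := polygonVertex_inj (h2 _) (hr j hj) (hcol d j) (h2 _) (hr i hi) (hcol c i) this
    obtain rfl := hκ.injective this.1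
    exact hcd (Fin.ext (columnIndex_injective κ j this.2.symm))
  · exact ⟨_, ⟨_, hcol c a, rfl⟩, a, a.2, rfl⟩

theorem le_two_mul_treewidth_hypergrid {r : ℕ} (hr : 4 ≤ r) :
    r ≤ 2 * treewidth (hypergrid r) := by
  have h : r + 1 - r / 2 ≤ treewidth (hypergrid r) + 1 := by
    -- Only the outer half of the levels is used, so that the innermost row, with `2 ^ (r / 2)`
    -- vertices, has room for all columns.
    refine le_treewidth_of_levels (κ := fun i => r / 2 + i) (fun _ _ h => by simpa using h)
      (by omega) (fun i hi => by omega) ?_ id Function.injective_id.injOn fun _ _ _ _ h => h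
    obtain ⟨d, hd⟩ := Nat.exists_eq_add_of_le' (show 2 ≤ r / 2 by omega)
    have : d < 2 ^ d := Nat.lt_two_pow_self
    rw [add_zero, hd, pow_add]
    omega
  omega

theorem log_le_treewidth_subHypergrid {r : ℕ} (hr : 8 ≤ r) :
    Nat.log 2 r ≤ 2 * treewidth (subHypergrid r) + 3 := by
  classical
  have hM : 3 ≤ Nat.log 2 r := Nat.le_log_of_pow_le one_lt_two hr
  have hp : 2 ^ Nat.log 2 r ≤ r := Nat.pow_log_le_self 2 (by omega)
  generalize Nat.log 2 r = M at *
  have hmem : ∀ v : HypergridVertex r, (∃ i < M + 1 - (3 + (M - 3) / 2),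
      hypergridLevel r v = 2 ^ (3 + (M - 3) / 2 + i)) → v ∈ subHypergridSet r :=
    fun v ⟨i, _, hi⟩ => .inr ⟨_, by omega, hi⟩
  have h : M + 1 - (3 + (M - 3) / 2) ≤ treewidth (subHypergrid r) + 1 := by
    -- Again the outer half, now of the exponents `3, ..., M`. The embedding below sends vertices
    -- outside the subgraph to the root, but none lies on these levels.
    refine le_treewidth_of_levels (κ := fun i => 2 ^ (3 + (M - 3) / 2 + i))
      (fun a b h => Nat.pow_lt_pow_right one_lt_two (by omega))
      (le_trans (by norm_num) (Nat.pow_le_pow_right two_pos (show 3 ≤ _ by omega)))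
      (fun i hi => (Nat.pow_le_pow_right two_pos (by omega)).trans hp) ?_
      (fun v => if h : v ∈ subHypergridSet r then ⟨v, h⟩ else ⟨none, .inl rfl⟩)
      (fun u hu v hv h => ?_) (fun u v hu hv h => ?_)
    · have h1 : 3 + (M - 3) / 2 < 2 ^ (3 + (M - 3) / 2) := Nat.lt_two_pow_self
      have h2 : 2 ^ (3 + (M - 3) / 2) < 2 ^ 2 ^ (3 + (M - 3) / 2) := Nat.lt_two_pow_self
      rw [add_zero]
      omega
    · simp only [dif_pos (hmem u hu), dif_pos (hmem v hv)] at h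
      exact congrArg Subtype.val h
    · simp only [dif_pos (hmem u hu), dif_pos (hmem v hv)]
      exact h
  omega

/-! ### Cliques -/

/-- The difference is `2 * sin ((t - 1) * π / (2 * N)) * cos ((t + 1) * π / (2 * N))`, and the
bounds on `t` make both factors nonnegative. -/
theorem sin_mul_pi_div_ge {N t : ℕ} (h1 : 1 ≤ t) (h2 : t + 1 ≤ N) :
    Real.sin (Real.pi / N) ≤ Real.sin (t * Real.pi / N) := by
  have hN : (0 : ℝ) < N := by exact_mod_cast (by omega : 0 < N)
  have ht : (1 : ℝ) ≤ t := by exact_mod_cast h1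
  have htN : (t : ℝ) + 1 ≤ N := by exact_mod_cast h2
  rw [← sub_nonneg, Real.sin_sub_sin]
  have e1 : (t * Real.pi / N - Real.pi / N) / 2 = Real.pi * ((t - 1) / (2 * N)) := by
    field_simp
  have e2 : (t * Real.pi / N + Real.pi / N) / 2 = Real.pi / 2 * ((t + 1) / N) := by
    field_simp
  have b1 : ((t : ℝ) - 1) / (2 * N) ≤ 1 := by rw [div_le_one (by positivity)]; linarith
  have b2 : ((t : ℝ) + 1) / N ≤ 1 := by rw [div_le_one hN]; linarith
  have b3 : 0 ≤ ((t : ℝ) - 1) / (2 * N) := div_nonneg (by linarith) (by positivity)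
  have b4 : 0 ≤ ((t : ℝ) + 1) / N := by positivity
  have hpi := Real.pi_pos
  rw [e1, e2]
  refine mul_nonneg (mul_nonneg two_pos.le (Real.sin_nonneg_of_nonneg_of_le_pi ?_ ?_))
    (Real.cos_nonneg_of_neg_pi_div_two_le_of_le ?_ ?_) <;> nlinarith

theorem sin_mul_pi_div_gt {N t : ℕ} (h1 : 2 ≤ t) (h2 : t + 2 ≤ N) :
    Real.sin (Real.pi / N) < Real.sin (t * Real.pi / N) := by
  have hN : (0 : ℝ) < N := by exact_mod_cast (by omega : 0 < N)
  have ht : (2 : ℝ) ≤ t := by exact_mod_cast h1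
  have htN : (t : ℝ) + 2 ≤ N := by exact_mod_cast h2
  rw [← sub_pos, Real.sin_sub_sin]
  have e1 : (t * Real.pi / N - Real.pi / N) / 2 = Real.pi * ((t - 1) / (2 * N)) := by
    field_simp
  have e2 : (t * Real.pi / N + Real.pi / N) / 2 = Real.pi / 2 * ((t + 1) / N) := by
    field_simp
  have b1 : ((t : ℝ) - 1) / (2 * N) < 1 := by rw [div_lt_one (by positivity)]; linarith
  have b2 : ((t : ℝ) + 1) / N < 1 := by rw [div_lt_one hN]; linarith
  have b3 : 0 < ((t : ℝ) - 1) / (2 * N) := div_pos (by linarith) (by positivity)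
  have b4 : 0 < ((t : ℝ) + 1) / N := by positivity
  have hpi := Real.pi_pos
  rw [e1, e2]
  refine mul_pos (mul_pos two_pos (Real.sin_pos_of_pos_of_lt_pi ?_ ?_))
    (Real.cos_pos_of_mem_Ioo ⟨?_, ?_⟩) <;> nlinarith

theorem sin_pi_div_le_abs_sin {N : ℕ} (hN : 0 < N) {m : ℤ} (hm : ¬ (N : ℤ) ∣ m) :
    Real.sin (Real.pi / N) ≤ |Real.sin (m * Real.pi / N)| := by
  have hN' : (N : ℤ) ≠ 0 := by omega
  have h0 : 0 ≤ m % N := Int.emod_nonneg _ hN'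
  have h1 : m % N < N := Int.emod_lt_of_pos _ (by omega)
  have h2 : m % N ≠ 0 := fun h => hm (Int.dvd_of_emod_eq_zero h)
  obtain ⟨t, ht⟩ := Int.eq_ofNat_of_zero_le h0
  have hdiv := Int.emod_add_mul_ediv m N
  rw [ht] at hdiv
  have hmr : (m : ℝ) = t + N * (m / (N : ℤ) : ℤ) := by exact_mod_cast hdiv.symm
  have hNr : (N : ℝ) ≠ 0 := by exact_mod_cast hN.ne'
  have : (m : ℝ) * Real.pi / N = t * Real.pi / N + (m / (N : ℤ) : ℤ) * Real.pi := by
    rw [hmr]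
    field_simp
  rw [this, Real.sin_add_int_mul_pi, abs_mul, abs_zpow, abs_neg, abs_one, one_zpow, one_mul]
  exact (sin_mul_pi_div_ge (by omega) (by omega)).trans (le_abs_self _)

/-- On one level the angular bound becomes `sin ((j - i) * π / 2 ^ k) ≤ sin (π / 2 ^ k)`. The second
alternative is the closing edge, `i = 0` and `j = 2 ^ k - 1`. -/
theorem index_of_hypergrid_adj {r k i j : ℕ} (hk : 2 ≤ k) (hkr : k ≤ r) (hi : i < 2 ^ k)
    (hj : j < 2 ^ k) (hij : i < j)
    (h : (hypergrid r).Adj (polygonVertex r k i) (polygonVertex r k j)) :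
    j = i + 1 ∨ j + 1 = i + 2 ^ k := by
  by_contra hne
  push Not at hne
  have h1 := sq_sin_le_of_hypergrid_adj hk hkr hi hk hkr hj h
  have h2 := sin_mul_pi_div_gt (N := 2 ^ k) (t := j - i) (by omega) (by omega)
  have h3 := sin_pi_div_two_pow_pos (k := k) (by omega)
  have e : ((2 * (i : ℝ) + 1) * Real.pi / 2 ^ k - (2 * (j : ℝ) + 1) * Real.pi / 2 ^ k) / 2 =
      -(((j - i : ℕ) : ℝ) * Real.pi / (2 ^ k : ℕ)) := by
    rw [Nat.cast_sub hij.le]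
    push_cast
    ring
  rw [e, Real.sin_neg, neg_sq, ← sq] at h1
  push_cast at h1 h2
  nlinarith

/-- Half the angle difference is an odd multiple of `π / 2 ^ (l + 1)`, hence at least that far from
every multiple of `π`. -/
theorem le_abs_sin_of_lt {k l : ℕ} (hkl : k < l) (i j : ℕ) : 1 / 2 ^ l ≤
    |Real.sin (((2 * (i : ℝ) + 1) * Real.pi / 2 ^ k - (2 * (j : ℝ) + 1) * Real.pi / 2 ^ l) / 2)| := by
  obtain ⟨d, rfl⟩ := Nat.exists_eq_add_of_lt hkl
  have h := sin_pi_div_le_abs_sin (N := 2 ^ (k + d + 2))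
    (m := (2 * i + 1) * 2 ^ (d + 1) - (2 * j + 1)) (by positivity) (fun h => by
      have h2 : (2 : ℤ) ∣ (2 ^ (k + d + 2) : ℕ) := by
        push_cast
        exact dvd_pow_self 2 (by omega)
      have h3 := h2.trans h
      rw [pow_succ, ← mul_assoc] at h3
      omega)
  have h4 := le_sin_pi_div_two_pow (k := k + d + 2) (by omega)
  push_cast at h
  have e : (((2 * (i : ℝ) + 1) * 2 ^ (d + 1) - (2 * j + 1)) * Real.pi / 2 ^ (k + d + 2)) =
    (((2 * (i : ℝ) + 1) * Real.pi / 2 ^ k - (2 * (j : ℝ) + 1) * Real.pi / 2 ^ (k + d + 1)) / 2) := by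
    simp only [pow_add]
    field_simp
  rw [e] at h
  refine le_trans (le_of_eq ?_) (h4.trans h)
  rw [pow_succ _ (k + d + 1)]
  field_simp

theorem abs_sin_half_sub_le (a b c : ℝ) : |Real.sin ((a - c) / 2)| ≤
    |Real.sin ((a - b) / 2)| + |Real.sin ((c - b) / 2)| := by
  have e : (a - c) / 2 = (a - b) / 2 - (c - b) / 2 := by ring
  rw [e, Real.sin_sub]
  refine (abs_sub _ _).trans ?_
  rw [abs_mul, abs_mul]
  exact add_le_add (mul_le_of_le_one_right (abs_nonneg _) (Real.abs_cos_le_one _))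
    (mul_le_of_le_one_left (abs_nonneg _) (Real.abs_cos_le_one _))

/-- A common neighbour on level `k₃` forces the two inner vertices close in angle, but
`le_abs_sin_of_lt` keeps them apart. The result is `1 / 4 ^ k₂ ≤ 4 * π ^ 2 / 2 ^ (k₁ + k₃)`, and `4
* π ^ 2 < 2 ^ 6`. -/
theorem levels_of_triangle {r k₁ k₂ k₃ j₁ j₂ j₃ : ℕ} (hk : 2 ≤ k₁) (h12 : k₁ < k₂) (h23 : k₂ < k₃)
    (hr : k₃ ≤ r) (hj₁ : j₁ < 2 ^ k₁) (hj₂ : j₂ < 2 ^ k₂) (hj₃ : j₃ < 2 ^ k₃)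
    (h13 : (hypergrid r).Adj (polygonVertex r k₁ j₁) (polygonVertex r k₃ j₃))
    (h23' : (hypergrid r).Adj (polygonVertex r k₂ j₂) (polygonVertex r k₃ j₃)) :
    k₁ + k₃ < 2 * k₂ + 6 := by
  have a13 := sq_sin_le_of_hypergrid_adj hk (by omega) hj₁ (by omega) hr hj₃ h13
  have a23 := sq_sin_le_of_hypergrid_adj (by omega) (by omega) hj₂ (by omega) hr hj₃ h23'
  have lower := le_abs_sin_of_lt h12 j₁ j₂
  have tri := abs_sin_half_sub_le ((2 * (j₁ : ℝ) + 1) * Real.pi / 2 ^ k₁)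
    ((2 * (j₃ : ℝ) + 1) * Real.pi / 2 ^ k₃) ((2 * (j₂ : ℝ) + 1) * Real.pi / 2 ^ k₂)
  rw [← sq_abs] at a13 a23
  have s12 := sin_pi_div_two_pow_anti (k := k₁) (by omega) h12.le
  have s1 := sin_pi_div_two_pow_pos (k := k₁) (by omega)
  have s3 := sin_pi_div_two_pow_pos (k := k₃) (by omega)
  have a23' := a23.trans (mul_le_mul_of_nonneg_right s12 s3.le)
  have up : Real.sin (Real.pi / 2 ^ k₁) * Real.sin (Real.pi / 2 ^ k₃) ≤
      Real.pi / 2 ^ k₁ * (Real.pi / 2 ^ k₃) :=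
    mul_le_mul (sin_pi_div_two_pow_le _) (sin_pi_div_two_pow_le _) s3.le (by positivity)
  have l0 : (0 : ℝ) < 1 / 2 ^ k₂ := by positivity
  have hsq : (1 / 2 ^ k₂ : ℝ) ^ 2 ≤ 4 * (Real.pi / 2 ^ k₁ * (Real.pi / 2 ^ k₃)) := by
    have h1 := pow_le_pow_left₀ l0.le (lower.trans tri) 2
    refine h1.trans (add_sq_le.trans ?_)
    linarith
  have hpi : Real.pi * Real.pi < 16 := by nlinarith [Real.pi_lt_four, Real.pi_pos]
  have hfin : (2 : ℝ) ^ (k₁ + k₃) < 2 ^ (2 * k₂ + 6) := by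
    rw [div_pow, one_pow, div_mul_div_comm, ← pow_add, ← pow_mul, mul_div_assoc',
      div_le_div_iff₀ (by positivity) (by positivity), one_mul, mul_comm k₂ 2] at hsq
    rw [pow_add _ (2 * k₂)]
    have : (0 : ℝ) < 2 ^ (2 * k₂) := by positivity
    nlinarith
  exact (pow_lt_pow_iff_right₀ one_lt_two).1 hfin

section Clique

variable {r : ℕ} {s : Finset (HypergridVertex r)}

theorem exists_of_mem_levels [DecidableEq (HypergridVertex r)] {k : ℕ}
    (hk : k ∈ (s.erase none).image (hypergridLevel r)) :
    2 ≤ k ∧ k ≤ r ∧ ∃ j < 2 ^ k, polygonVertex r k j ∈ s := by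
  obtain ⟨v, hv, rfl⟩ := Finset.mem_image.1 hk
  rw [Finset.mem_erase] at hv
  obtain ⟨k, j, hk2, hkr, hj, rfl⟩ := exists_eq_polygonVertex hv.1
  rw [hypergridLevel_polygonVertex hk2 hkr hj]
  exact ⟨hk2, hkr, j, hj, hv.2⟩

theorem levels_of_isClique [DecidableEq (HypergridVertex r)] (hs : (hypergrid r).IsClique s)
    {a b c : ℕ} (ha : a ∈ (s.erase none).image (hypergridLevel r))
    (hb : b ∈ (s.erase none).image (hypergridLevel r))
    (hc : c ∈ (s.erase none).image (hypergridLevel r)) (hab : a < b) (hbc : b < c) :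
    a + c < 2 * b + 6 := by
  obtain ⟨ha2, har, i, hi, his⟩ := exists_of_mem_levels ha
  obtain ⟨hb2, hbr, j, hj, hjs⟩ := exists_of_mem_levels hb
  obtain ⟨hc2, hcr, l, hl, hls⟩ := exists_of_mem_levels hc
  refine levels_of_triangle ha2 hab hbc hcr hi hj hl (hs his hls fun h => ?_)
    (hs hjs hls fun h => ?_)
  · have := polygonVertex_inj ha2 har hi hc2 hcr hl h
    omega
  · have := polygonVertex_inj hb2 hbr hj hc2 hcr hl h
    omega

theorem card_level_le_two [DecidableEq (HypergridVertex r)] (hs : (hypergrid r).IsClique s)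
    (k : ℕ) : {v ∈ s.erase none | hypergridLevel r v = k}.card ≤ 2 := by
  by_contra! h
  obtain ⟨u, hu, v, hv, w, hw, huv, huw, hvw⟩ := Finset.two_lt_card.1 h
  have key : ∀ x ∈ {v ∈ s.erase none | hypergridLevel r v = k},
      2 ≤ k ∧ k ≤ r ∧ x ∈ s ∧ ∃ j < 2 ^ k, x = polygonVertex r k j := by
    intro x hx
    rw [Finset.mem_filter, Finset.mem_erase] at hx
    obtain ⟨l, j, hl, hlr, hj, rfl⟩ := exists_eq_polygonVertex hx.1.1
    rw [hypergridLevel_polygonVertex hl hlr hj] at hx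
    obtain rfl := hx.2
    exact ⟨hl, hlr, hx.1.2, j, hj, rfl⟩
  obtain ⟨hk, hkr, hus, a, ha, rfl⟩ := key u hu
  obtain ⟨-, -, hvs, b, hb, rfl⟩ := key v hv
  obtain ⟨-, -, hws, c, hc, rfl⟩ := key w hw
  -- A cycle of length at least four contains no triangle.
  have hN : 4 ≤ 2 ^ k := Nat.pow_le_pow_right two_pos hk
  have pair : ∀ x < 2 ^ k, ∀ y < 2 ^ k, polygonVertex r k x ∈ s → polygonVertex r k y ∈ s →
      polygonVertex r k x ≠ polygonVertex r k y →
      y = x + 1 ∨ y + 1 = x + 2 ^ k ∨ x = y + 1 ∨ x + 1 = y + 2 ^ k := by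
    intro x hx y hy hxs hys hne
    rcases lt_trichotomy x y with h | h | h
    · have := index_of_hypergrid_adj hk hkr hx hy h (hs hxs hys hne)
      omega
    · exact absurd (by rw [h]) hne
    · have := index_of_hypergrid_adj hk hkr hy hx h (hs hys hxs hne.symm)
      omega
  have p1 := pair a ha b hb hus hvs huv
  have p2 := pair a ha c hc hus hws huw
  have p3 := pair b hb c hc hvs hws hvw
  have n1 : a ≠ b := fun h => huv (by rw [h])
  have n2 : a ≠ c := fun h => huw (by rw [h])
  have n3 : b ≠ c := fun h => hvw (by rw [h])
  omega

theorem card_clique_le [DecidableEq (HypergridVertex r)] (hs : (hypergrid r).IsClique s) :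
    s.card ≤ 2 * ((s.erase none).image (hypergridLevel r)).card + 1 := by
  have h1 := Finset.card_le_mul_card_image (f := hypergridLevel r) (s.erase none) 2
    fun k _ => card_level_le_two hs k
  have h2 := Finset.pred_card_le_card_erase (s := s) (a := none)
  omega

end Clique

/-- In terms of gaps `g k = M - k` the hypothesis is `2 * g b < g a + 6`. Removing the smallest
element thus improves the bound `g < 5 + 2 ^ (n + 1)` to `g < 5 + 2 ^ n`; at `n = 0` only the gaps
`0, ..., 5` remain. -/
theorem card_le_of_halving_gaps {M : ℕ} (n : ℕ) : ∀ L : Finset ℕ, (∀ k ∈ L, k ≤ M) →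
    (∀ k ∈ L, M < k + 5 + 2 ^ n) → (∀ a ∈ L, ∀ b ∈ L, a < b → b < M → a + M < 2 * b + 6) →
    L.card ≤ 6 + n := by
  induction n with
  | zero =>
    intro L hM hL _
    have : L ⊆ Finset.Icc (M - 5) M := fun k hk => by
      have := hM k hk
      have := hL k hk
      rw [Finset.mem_Icc]
      omega
    have := Finset.card_le_card this
    rw [Nat.card_Icc] at this
    omega
  | succ n ih =>
    intro L hM hL h
    rcases L.eq_empty_or_nonempty with rfl | hne
    · simp
    have hmem := L.min'_mem hne
    have := ih (L.erase (L.min' hne)) (fun k hk => hM k (Finset.mem_of_mem_erase hk))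
      (fun k hk => ?_) (fun a ha b hb => h a (Finset.mem_of_mem_erase ha) b
        (Finset.mem_of_mem_erase hb))
    · rw [Finset.card_erase_of_mem hmem] at this
      omega
    · have hk' := Finset.mem_of_mem_erase hk
      have hlt := L.min'_lt_of_mem_erase_min' hne hk
      have h1 := hM k hk'
      have h2 := hL _ hmem
      have h3 := h _ hmem k hk' hlt
      have h4 : 0 < 2 ^ n := by positivity
      rw [pow_succ] at h2
      omega

theorem card_le_two_of_no_chain {L : Finset ℕ}
    (h : ∀ a ∈ L, ∀ b ∈ L, ∀ c ∈ L, ¬(a < b ∧ b < c)) : L.card ≤ 2 := by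
  by_contra! hc
  obtain ⟨a, ha, b, hb, c, hc, hab, hac, hbc⟩ := Finset.two_lt_card.1 hc
  have := h a ha b hb c hc
  have := h a ha c hc b hb
  have := h b hb a ha c hc
  have := h b hb c hc a ha
  have := h c hc a ha b hb
  have := h c hc b hb a ha
  omega

theorem cliqueNum_hypergrid_le (r : ℕ) : (hypergrid r).cliqueNum ≤ 2 * Nat.log 2 r + 15 := by
  classical
  obtain ⟨s, hs⟩ := (hypergrid r).exists_isNClique_cliqueNum
  rw [← hs.card_eq]
  have h1 := card_clique_le hs.isClique
  set L := (s.erase none).image (hypergridLevel r) with hL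
  rcases L.eq_empty_or_nonempty with h | hne
  · rw [h, Finset.card_empty] at h1
    omega
  -- All gaps are at most `r < 2 ^ (Nat.log 2 r + 1)`. Two vertices on each of `7 + Nat.log 2 r`
  -- levels and the root give the bound.
  have h2 := card_le_of_halving_gaps (M := L.max' hne) (Nat.log 2 r + 1) L
    (fun k hk => L.le_max' k hk) (fun k _ => ?_)
    (fun a ha b hb hab hbM => levels_of_isClique hs.isClique ha hb (L.max'_mem hne) hab hbM)
  · omega
  · have h3 := (exists_of_mem_levels (L.max'_mem hne)).2.1
    have h4 : r < 2 ^ (Nat.log 2 r + 1) := Nat.lt_pow_succ_log_self one_lt_two r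
    omega

theorem cliqueNum_subHypergrid_le (r : ℕ) : (subHypergrid r).cliqueNum ≤ 5 := by
  classical
  obtain ⟨t, ht⟩ := (subHypergrid r).exists_isNClique_cliqueNum
  rw [← ht.card_eq]
  have hs : (hypergrid r).IsClique (t.map (Function.Embedding.subtype _) :
      Finset (HypergridVertex r)) := by
    intro u hu v hv huv
    simp only [Finset.coe_map, Set.mem_image] at hu hv
    obtain ⟨u, hu, rfl⟩ := hu
    obtain ⟨v, hv, rfl⟩ := hv
    exact ht.isClique hu hv fun h => huv (by rw [h])
  have h1 := card_clique_le hs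
  have h2 : (((t.map (Function.Embedding.subtype _)).erase none).image
      (hypergridLevel r)).card ≤ 2 := by
    have key : ∀ k ∈ ((t.map (Function.Embedding.subtype _)).erase none).image
        (hypergridLevel r), ∃ m, 3 ≤ m ∧ k = 2 ^ m := by
      intro k hk
      obtain ⟨v, hv, rfl⟩ := Finset.mem_image.1 hk
      rw [Finset.mem_erase, Finset.mem_map] at hv
      obtain ⟨hv0, w, -, rfl⟩ := hv
      exact w.2.resolve_left hv0
    -- For powers of two `a < b < c` with `a ≥ 8`, already `c ≥ 2 * b` contradicts `a + c < 2 * b +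
    -- 6`.
    refine card_le_two_of_no_chain fun a ha b hb c hc ⟨hab, hbc⟩ => ?_
    have h := levels_of_isClique hs ha hb hc hab hbc
    obtain ⟨m, hm, rfl⟩ := key a ha
    obtain ⟨m', -, rfl⟩ := key b hb
    obtain ⟨m'', -, rfl⟩ := key c hc
    have h8 : 2 ^ 3 ≤ 2 ^ m := Nat.pow_le_pow_right two_pos hm
    have hlt : m' < m'' := (Nat.pow_lt_pow_iff_right one_lt_two).1 hbc
    have h2 : 2 ^ (m' + 1) ≤ 2 ^ m'' := Nat.pow_le_pow_right two_pos hlt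
    rw [pow_succ] at h2
    omega
  rw [Finset.card_map] at h1
  omega

/-! ### Numbers of vertices -/

theorem card_hypergridVertex_le (r : ℕ) : Nat.card (HypergridVertex r) ≤ 2 ^ (r + 1) := by
  rw [Nat.card_eq_fintype_card, Fintype.card_option, Fintype.card_sigma]
  simp only [Fintype.card_fin]
  rw [Finset.sum_coe_sort (Finset.Icc 2 r) fun k => 2 ^ k]
  have h : ∑ k ∈ Finset.Icc 2 r, 2 ^ k ≤ ∑ k ∈ Finset.range (r + 1), 2 ^ k :=
    Finset.sum_le_sum_of_subset fun k hk => by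
      rw [Finset.mem_Icc] at hk
      rw [Finset.mem_range]
      omega
  rw [Nat.geomSum_eq le_rfl] at h
  have : 0 < 2 ^ (r + 1) := by positivity
  omega

theorem two_pow_le_card_set {r k : ℕ} (hk : 2 ≤ k) (hkr : k ≤ r) {S : Set (HypergridVertex r)}
    (hS : ∀ v, hypergridLevel r v = k → v ∈ S) : 2 ^ k ≤ Nat.card S := by
  rw [← Nat.card_fin (2 ^ k)]
  refine Nat.card_le_card_of_injective (fun j : Fin (2 ^ k) => (⟨polygonVertex r k j,
    hS _ (hypergridLevel_polygonVertex hk hkr j.2)⟩ : S)) fun i j h => ?_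
  exact Fin.ext (polygonVertex_inj hk hkr i.2 hk hkr j.2 (congrArg Subtype.val h)).2

theorem two_pow_le_card_hypergridVertex {r : ℕ} (hr : 2 ≤ r) :
    2 ^ r ≤ Nat.card (HypergridVertex r) := by
  rw [← Nat.card_congr (Equiv.Set.univ (HypergridVertex r))]
  exact two_pow_le_card_set hr le_rfl fun _ _ => trivial

theorem card_subHypergridSet_le (r : ℕ) : Nat.card (subHypergridSet r) ≤ 2 ^ (r + 1) :=
  (Nat.card_le_card_of_injective _ Subtype.val_injective).trans (card_hypergridVertex_le r)

/-- The largest power of two up to `r` exceeds `r / 2`, and that level alone suffices. The squared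
form is the growth hypothesis shared by both families below. -/
theorem two_pow_le_card_subHypergridSet_sq {r : ℕ} (hr : 8 ≤ r) :
    2 ^ r ≤ Nat.card (subHypergridSet r) ^ 2 := by
  have hM : 3 ≤ Nat.log 2 r := Nat.le_log_of_pow_le one_lt_two hr
  have hp : 2 ^ Nat.log 2 r ≤ r := Nat.pow_log_le_self 2 (by omega)
  have hlt : r < 2 ^ (Nat.log 2 r + 1) := Nat.lt_pow_succ_log_self one_lt_two r
  have h8 : 2 ^ 3 ≤ 2 ^ Nat.log 2 r := Nat.pow_le_pow_right two_pos hM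
  have h := two_pow_le_card_set (S := subHypergridSet r) (by omega) hp
    fun v hv => .inr ⟨_, hM, hv⟩
  calc 2 ^ r ≤ (2 ^ 2 ^ Nat.log 2 r) ^ 2 := by
        rw [← pow_mul]
        exact Nat.pow_le_pow_right two_pos (by rw [← pow_succ]; exact hlt.le)
    _ ≤ _ := Nat.pow_le_pow_left h 2

/-! ### Asymptotics -/

open Filter Asymptotics

section Growth

variable {N : ℕ → ℕ} {r₀ : ℕ}

theorem le_three_mul_log_of_two_pow_le_sq {n r : ℕ} (h : 2 ^ r ≤ n ^ 2) :
    (r : ℝ) ≤ 3 * Real.log n := by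
  have h' : (2 : ℝ) ^ r ≤ (n : ℝ) ^ 2 := by exact_mod_cast h
  have h1 := Real.log_le_log (by positivity) h'
  rw [Real.log_pow, Real.log_pow] at h1
  push_cast at h1
  have h2 := Real.log_two_gt_d9
  have h3 : (0 : ℝ) ≤ r := r.cast_nonneg
  nlinarith

theorem log_le_of_le_two_pow {n r : ℕ} (hr : 1 ≤ r) (h : n ≤ 2 ^ (r + 1)) :
    Real.log n ≤ 2 * r := by
  have hr' : (1 : ℝ) ≤ r := by exact_mod_cast hr
  rcases Nat.eq_zero_or_pos n with rfl | hn
  · simp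
  have h' : (n : ℝ) ≤ 2 ^ (r + 1) := by exact_mod_cast h
  have h1 := Real.log_le_log (by exact_mod_cast hn) h'
  rw [Real.log_pow] at h1
  push_cast at h1
  have h2 := Real.log_two_lt_d9
  nlinarith

theorem tendsto_of_two_pow_le_sq (h : ∀ r ≥ r₀, 2 ^ r ≤ N r ^ 2) : Tendsto N atTop atTop := by
  have h1 : Tendsto (fun r => N r ^ 2) atTop atTop :=
    tendsto_atTop_mono' _ (eventually_atTop.2 ⟨r₀, h⟩)
      (tendsto_pow_atTop_atTop_of_one_lt one_lt_two)
  refine tendsto_atTop.2 fun b => ?_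
  filter_upwards [tendsto_atTop.1 h1 (b ^ 2)] with r hr
  exact (Nat.pow_le_pow_iff_left two_ne_zero).1 hr

theorem isTheta_log (h : ∀ r ≥ r₀, 2 ^ r ≤ N r ^ 2) (h' : ∀ r, N r ≤ 2 ^ (r + 1)) :
    (fun r : ℕ => (r : ℝ)) =Θ[atTop] fun r => Real.log (N r) := by
  constructor
  · refine IsBigO.of_bound 3 (eventually_atTop.2 ⟨r₀, fun r hr => ?_⟩)
    have := le_three_mul_log_of_two_pow_le_sq (h r hr)
    rw [Real.norm_of_nonneg r.cast_nonneg, Real.norm_of_nonneg (Real.log_natCast_nonneg _)]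
    exact this
  · refine IsBigO.of_bound 2 (eventually_atTop.2 ⟨1, fun r hr => ?_⟩)
    rw [Real.norm_of_nonneg r.cast_nonneg, Real.norm_of_nonneg (Real.log_natCast_nonneg _)]
    exact log_le_of_le_two_pow hr (h' r)

theorem log_isTheta_log_log (h : ∀ r ≥ r₀, 2 ^ r ≤ N r ^ 2) (h' : ∀ r, N r ≤ 2 ^ (r + 1)) :
    (fun r : ℕ => Real.log r) =Θ[atTop] fun r => Real.log (Real.log (N r)) := by
  -- From `r ≥ 9` on, `log n ≥ r / 3 ≥ 3`, so `r ≤ 3 * log n ≤ (log n) ^ 2`; likewise `log n ≤ 2 * r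
  -- ≤ r ^ 2`.
  have key : ∀ r ≥ max r₀ 9, 0 ≤ Real.log (Real.log (N r)) ∧
      Real.log r ≤ 2 * Real.log (Real.log (N r)) ∧ Real.log (Real.log (N r)) ≤ 2 * Real.log r := by
    intro r hr
    have h1 := le_three_mul_log_of_two_pow_le_sq (h r (by omega))
    have h2 := log_le_of_le_two_pow (by omega) (h' r)
    have h9 : (9 : ℝ) ≤ r := by exact_mod_cast (by omega : 9 ≤ r)
    refine ⟨Real.log_nonneg (by linarith), ?_, ?_⟩
    · have := Real.log_le_log (by linarith) (show (r : ℝ) ≤ Real.log (N r) ^ 2 by nlinarith)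
      rwa [Real.log_pow] at this
    · have := Real.log_le_log (by linarith) (show Real.log (N r) ≤ (r : ℝ) ^ 2 by nlinarith)
      rwa [Real.log_pow] at this
  constructor
  · refine IsBigO.of_bound 2 (eventually_atTop.2 ⟨max r₀ 9, fun r hr => ?_⟩)
    rw [Real.norm_of_nonneg (Real.log_natCast_nonneg _), Real.norm_of_nonneg (key r hr).1]
    exact (key r hr).2.1
  · refine IsBigO.of_bound 2 (eventually_atTop.2 ⟨max r₀ 9, fun r hr => ?_⟩)
    rw [Real.norm_of_nonneg (Real.log_natCast_nonneg _), Real.norm_of_nonneg (key r hr).1]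
    exact (key r hr).2.2

end Growth

theorem cliqueNum_hypergrid_isBigO :
    (fun r : ℕ => ((hypergrid r).cliqueNum : ℝ)) =O[atTop] fun r : ℕ => Real.log r := by
  -- Here `2 / log 2 < 4`, and `r ≥ 3` gives `log r ≥ 1`, which absorbs the additive `15`.
  refine IsBigO.of_bound 19 (eventually_atTop.2 ⟨3, fun r hr => ?_⟩)
  rw [Real.norm_of_nonneg (Nat.cast_nonneg _), Real.norm_of_nonneg (Real.log_natCast_nonneg _)]
  have h1 : ((hypergrid r).cliqueNum : ℝ) ≤ 2 * Nat.log 2 r + 15 := by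
    exact_mod_cast cliqueNum_hypergrid_le r
  have h2 : (2 : ℝ) ^ Nat.log 2 r ≤ r := by
    exact_mod_cast Nat.pow_log_le_self 2 (by omega)
  have h3 := Real.log_le_log (by positivity) h2
  rw [Real.log_pow] at h3
  have h4 := Real.log_two_gt_d9
  have h5 : (0 : ℝ) ≤ Nat.log 2 r := Nat.cast_nonneg _
  have h6 : 1 ≤ Real.log r := by
    rw [Real.le_log_iff_exp_le (by positivity)]
    have : (3 : ℝ) ≤ r := by exact_mod_cast hr
    linarith [Real.exp_one_lt_d9]
  nlinarith

theorem isBigO_treewidth_hypergrid :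
    (fun r : ℕ => (r : ℝ)) =O[atTop] fun r => (treewidth (hypergrid r) : ℝ) := by
  refine IsBigO.of_bound 2 (eventually_atTop.2 ⟨4, fun r hr => ?_⟩)
  rw [Real.norm_of_nonneg (Nat.cast_nonneg _), Real.norm_of_nonneg (Nat.cast_nonneg _)]
  exact_mod_cast le_two_mul_treewidth_hypergrid hr

theorem log_isBigO_treewidth_subHypergrid :
    (fun r : ℕ => Real.log r) =O[atTop] fun r => (treewidth (subHypergrid r) : ℝ) := by
  refine IsBigO.of_bound 6 (eventually_atTop.2 ⟨16, fun r hr => ?_⟩)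
  rw [Real.norm_of_nonneg (Real.log_natCast_nonneg _), Real.norm_of_nonneg (Nat.cast_nonneg _)]
  -- For `r ≥ 16` the treewidth is positive, so the additive constants fit into the factor `6`.
  have h1 : Nat.log 2 r + 1 ≤ 6 * treewidth (subHypergrid r) := by
    have := log_le_treewidth_subHypergrid (r := r) (by omega)
    have : 4 ≤ Nat.log 2 r := Nat.le_log_of_pow_le one_lt_two hr
    omega
  have h2 : (r : ℝ) ≤ 2 ^ (Nat.log 2 r + 1) := by
    exact_mod_cast (Nat.lt_pow_succ_log_self one_lt_two r).le
  have h3 := Real.log_le_log (by exact_mod_cast (by omega : 0 < r)) h2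
  rw [Real.log_pow] at h3
  have h4 := Real.log_two_lt_d9
  have h5 : ((Nat.log 2 r + 1 : ℕ) : ℝ) ≤ 6 * treewidth (subHypergrid r) := by exact_mod_cast h1
  have h6 : (0 : ℝ) ≤ (Nat.log 2 r + 1 : ℕ) := Nat.cast_nonneg _
  nlinarith

theorem one_le_cliqueNum_subHypergrid (r : ℕ) : 1 ≤ (subHypergrid r).cliqueNum := by
  have h : (subHypergrid r).IsClique
      (({⟨none, .inl rfl⟩} : Finset (subHypergridSet r)) : Set (subHypergridSet r)) := by simp
  simpa using SimpleGraph.IsClique.card_le_cliqueNum (tc := h)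

theorem theorem4 :
    (Filter.Tendsto (fun r : ℕ => Nat.card (HypergridVertex r)) Filter.atTop Filter.atTop ∧
      (∀ r : ℕ, 2 ≤ r → IsSHUDG (hypergrid r) (r : ℝ)) ∧
      (fun r : ℕ => (r : ℝ)) =Θ[Filter.atTop]
        (fun r : ℕ => Real.log (Nat.card (HypergridVertex r))) ∧
      (fun r : ℕ => ((hypergrid r).cliqueNum : ℝ)) =O[Filter.atTop]
        (fun r : ℕ => Real.log (Real.log (Nat.card (HypergridVertex r)))) ∧
      (fun r : ℕ => Real.log (Nat.card (HypergridVertex r))) =O[Filter.atTop]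
        (fun r : ℕ => (treewidth (hypergrid r) : ℝ))) ∧
    (Filter.Tendsto (fun r : ℕ => Nat.card (subHypergridSet r)) Filter.atTop Filter.atTop ∧
      (∀ r : ℕ, 8 ≤ r → IsSHUDG (subHypergrid r) (r : ℝ)) ∧
      (fun r : ℕ => (r : ℝ)) =Θ[Filter.atTop]
        (fun r : ℕ => Real.log (Nat.card (subHypergridSet r))) ∧
      (∀ r : ℕ, 8 ≤ r → (subHypergrid r).cliqueNum ≤ 5) ∧
      (fun r : ℕ => ((subHypergrid r).cliqueNum : ℝ)) =Θ[Filter.atTop] (fun _ : ℕ => (1 : ℝ)) ∧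
      (fun r : ℕ => Real.log (Real.log (Nat.card (subHypergridSet r)))) =O[Filter.atTop]
        (fun r : ℕ => (treewidth (subHypergrid r) : ℝ))) := by
  have h : ∀ r ≥ 2, 2 ^ r ≤ Nat.card (HypergridVertex r) ^ 2 := fun r hr =>
    (two_pow_le_card_hypergridVertex hr).trans (Nat.le_self_pow two_ne_zero _)
  have h' : ∀ r ≥ 8, 2 ^ r ≤ Nat.card (subHypergridSet r) ^ 2 :=
    fun r hr => two_pow_le_card_subHypergridSet_sq hr
  refine ⟨⟨tendsto_of_two_pow_le_sq h, fun r hr => isSHUDG_hypergrid (by omega),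
    isTheta_log h card_hypergridVertex_le,
    cliqueNum_hypergrid_isBigO.trans (log_isTheta_log_log h card_hypergridVertex_le).1,
    (isTheta_log h card_hypergridVertex_le).2.trans isBigO_treewidth_hypergrid⟩,
    tendsto_of_two_pow_le_sq h', fun r hr => isSHUDG_subHypergrid (by omega),
    isTheta_log h' card_subHypergridSet_le, fun r _ => cliqueNum_subHypergrid_le r, ⟨?_, ?_⟩,
    (log_isTheta_log_log h' card_subHypergridSet_le).2.trans log_isBigO_treewidth_subHypergrid⟩
  · refine IsBigO.of_bound 5 (.of_forall fun r => ?_)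
    rw [Real.norm_of_nonneg (Nat.cast_nonneg _), norm_one, mul_one]
    exact_mod_cast cliqueNum_subHypergrid_le r
  · refine IsBigO.of_bound 1 (.of_forall fun r => ?_)
    rw [Real.norm_of_nonneg (Nat.cast_nonneg _), norm_one, one_mul]
    exact_mod_cast one_le_cliqueNum_subHypergrid r
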